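/- Let $p$ be an odd prime and let $R=\widehat{\mathbb Z_p^{ur}}$ be the $p$-adic completion of the maximal unramified extension of $\mathbb Z_p$, with $\phi:R\to R$ the unique ring endomorphism lifting the $p$-power Frobenius of $R/pR$. Let $R\{x\}=R[x,x',x'',\dots]$ be the polynomial ring in variables $x=x^{(0)},x'=x^{(1)},x''=x^{(2)},\dots$; extend $\phi$ to $R\{x\}$ by $\phi(x^{(i)})=(x^{(i)})^p+p\,x^{(i+1)}$ and let $\delta:R\{x\}\to R\{x\}$, $\delta f=(\phi(f)-f^p)/p$, be the corresponding $p$-derivation. For integers $n\ge 0$ and $\nu\ge 1$ let $$\mathcal O^n(\mu_{p^\nu})=\frac{R[x,x',\dots,x^{(n)}]\widehat{\ }}{\bigl(x^{p^\nu}-1,\ \delta(x^{p^\nu}-1),\ \dots,\ \delta^n(x^{p^\nu}-1)\bigr)}$$ be the ring of global functions on the $p$-jet space $J^n(\mu_{p^\nu})$ of order $n$ of the $R$-group scheme $\mu_{p^\nu}=\operatorname{Spec} R[x]/(x^{p^\nu}-1)$, where $\widehat{\ }$ denotes $p$-adic completion. Proposition 5.8. For all integers $n,\nu\ge 1$: 1)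 $\mathcal O^n(\mu_{p^\nu})$ is not a finite $R$-algebra (that is, it is not finitely generated as an $R$-module); 2) $\mathcal O^n(\mu_{p^\nu})$ is not a flat $R$-algebra. -/

import Mathlib

noncomputable section

namespace PJet

section UnramifiedExtension

variable (p : ℕ) [Fact p.Prime]

/-- `S` is a finite unramified `ℤ_p`-subalgebra of the algebraic closure of `ℚ_p`. -/
def IsFiniteUnramified (S : Subalgebra ℤ_[p] (PadicAlgCl p)) : Prop :=
  Module.Finite ℤ_[p] S ∧ Algebra.FormallyUnramified ℤ_[p] S

variable {p}

lemma IsFiniteUnramified.sup {S T : Subalgebra ℤ_[p] (PadicAlgCl p)}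
    (hS : IsFiniteUnramified p S) (hT : IsFiniteUnramified p T) :
    IsFiniteUnramified p (S ⊔ T) := by
  obtain ⟨_, _⟩ := hS
  obtain ⟨_, _⟩ := hT
  have e : (Algebra.TensorProduct.productMap S.val T.val).range = S ⊔ T := by
    rw [Algebra.TensorProduct.productMap_range, Subalgebra.range_val, Subalgebra.range_val]
  rw [← e]
  have : Algebra.FormallyUnramified ℤ_[p] (TensorProduct ℤ_[p] S T) :=
    Algebra.FormallyUnramified.comp ℤ_[p] S (TensorProduct ℤ_[p] S T)
  exact ⟨Module.Finite.of_surjective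
      (Algebra.TensorProduct.productMap S.val T.val).rangeRestrict.toLinearMap
      (AlgHom.rangeRestrict_surjective _),
    Algebra.FormallyUnramified.of_surjective
      (Algebra.TensorProduct.productMap S.val T.val).rangeRestrict
      (AlgHom.rangeRestrict_surjective _)⟩

lemma IsFiniteUnramified.map {S : Subalgebra ℤ_[p] (PadicAlgCl p)}
    (hS : IsFiniteUnramified p S) (σ : PadicAlgCl p →ₐ[ℤ_[p]] PadicAlgCl p) :
    IsFiniteUnramified p (S.map σ) := by
  obtain ⟨_, _⟩ := hS
  have e : (σ.comp S.val).range = S.map σ := by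
    rw [AlgHom.range_comp, Subalgebra.range_val]
  rw [← e]
  exact ⟨Module.Finite.of_surjective (σ.comp S.val).rangeRestrict.toLinearMap
      (AlgHom.rangeRestrict_surjective _),
    Algebra.FormallyUnramified.of_surjective (σ.comp S.val).rangeRestrict
      (AlgHom.rangeRestrict_surjective _)⟩

lemma isFiniteUnramified_bot : IsFiniteUnramified p ⊥ := by
  have h := AlgHom.rangeRestrict_surjective (Algebra.ofId ℤ_[p] (PadicAlgCl p))
  have e : (Algebra.ofId ℤ_[p] (PadicAlgCl p)).range = ⊥ := rfl
  rw [← e]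
  exact ⟨Module.Finite.of_surjective (Algebra.ofId _ _).rangeRestrict.toLinearMap h,
    Algebra.FormallyUnramified.of_surjective (Algebra.ofId _ _).rangeRestrict h⟩

variable (p)

/-- The maximal unramified extension `ℤ_p^ur` of the ring `ℤ_p`: the compositum, inside the
algebraic closure of `ℚ_p`, of all finite unramified extensions of `ℤ_p`
(it is their union, see `mem_Zur`). -/
def Zur : Subalgebra ℤ_[p] (PadicAlgCl p) := ⨆ S : {S // IsFiniteUnramified p S}, S.1

variable {p}

lemma mem_Zur {x : PadicAlgCl p} : x ∈ Zur p ↔ ∃ S, IsFiniteUnramified p S ∧ x ∈ S := by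
  have : Nonempty {S // IsFiniteUnramified p S} := ⟨⟨⊥, isFiniteUnramified_bot⟩⟩
  have h := Subalgebra.coe_iSup_of_directed (K := fun S : {S // IsFiniteUnramified p S} => S.1)
    (fun S T => ⟨⟨S.1 ⊔ T.1, S.2.sup T.2⟩, le_sup_left, le_sup_right⟩)
  rw [← SetLike.mem_coe, Zur, h]
  simp

lemma norm_le_one_of_isIntegral {x : PadicAlgCl p} (hx : IsIntegral ℤ_[p] x) : ‖x‖ ≤ 1 := by
  rw [← PadicAlgCl.spectralNorm_eq, spectralNorm,
    spectralValue_le_one_iff (minpoly.monic (Algebra.IsIntegral.isIntegral x)),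
    minpoly.isIntegrallyClosed_eq_field_fractions' ℚ_[p] hx]
  intro n
  rw [Polynomial.coeff_map]
  exact PadicInt.norm_le_one _

lemma norm_coeff_lt_one {x : PadicAlgCl p} (hx : ‖x‖ < 1) {n : ℕ}
    (hn : n < (minpoly ℚ_[p] x).natDegree) : ‖(minpoly ℚ_[p] x).coeff n‖ < 1 := by
  by_contra! h
  have h1 := le_ciSup (spectralValueTerms_bddAbove (minpoly ℚ_[p] x)) n
  rw [spectralValueTerms_of_lt_natDegree _ hn] at h1
  have h2 : (1:ℝ) ≤ ‖(minpoly ℚ_[p] x).coeff n‖ ^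
      (1 / ((minpoly ℚ_[p] x).natDegree - n : ℝ)) := by
    apply Real.one_le_rpow h
    have : (n:ℝ) < (minpoly ℚ_[p] x).natDegree := by exact_mod_cast hn
    apply one_div_nonneg.2; linarith
  have h3 : ‖x‖ = iSup (spectralValueTerms (minpoly ℚ_[p] x)) := rfl
  linarith

lemma isIntegral_of_mem {S : Subalgebra ℤ_[p] (PadicAlgCl p)} (hS : IsFiniteUnramified p S)
    {x : PadicAlgCl p} (hx : x ∈ S) : IsIntegral ℤ_[p] x := by
  have := hS.1
  exact (Algebra.IsIntegral.isIntegral (R := ℤ_[p]) (⟨x, hx⟩ : S)).map S.val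

lemma exists_eq_p_mul {S : Subalgebra ℤ_[p] (PadicAlgCl p)} (hS : IsFiniteUnramified p S)
    {y : PadicAlgCl p} (hy : y ∈ S) (h1 : ‖y‖ < 1) : ∃ z ∈ S, y = p * z := by
  have hint := isIntegral_of_mem hS hy
  obtain ⟨_, _⟩ := hS
  have hrad := Algebra.FormallyUnramified.isRadical_map_isMaximal (A := ℤ_[p]) S
    (IsLocalRing.maximalIdeal ℤ_[p])
  set y' : S := ⟨y, hy⟩ with hy'
  have hq : minpoly ℚ_[p] y = (minpoly ℤ_[p] y).map (algebraMap ℤ_[p] ℚ_[p]) :=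
    minpoly.isIntegrallyClosed_eq_field_fractions' ℚ_[p] hint
  have hmon := minpoly.monic hint
  have hdeg : (minpoly ℚ_[p] y).natDegree = (minpoly ℤ_[p] y).natDegree := by
    rw [hq, hmon.natDegree_map]
  have hev : Polynomial.aeval y' (minpoly ℤ_[p] y) = 0 := by
    apply Subtype.val_injective
    have := minpoly.aeval ℤ_[p] y
    rw [← Polynomial.aeval_subalgebra_coe _ S y'] at this
    simpa using this
  have hmem : y' ∈ (IsLocalRing.maximalIdeal ℤ_[p]).map (algebraMap ℤ_[p] S) := by
    apply hrad
    refine ⟨(minpoly ℤ_[p] y).natDegree, ?_⟩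
    rw [Polynomial.aeval_eq_sum_range, Finset.sum_range_succ, hmon.coeff_natDegree, one_smul] at hev
    rw [eq_neg_of_add_eq_zero_right hev]
    refine neg_mem (sum_mem fun i hi => ?_)
    rw [Algebra.smul_def]
    refine Ideal.mul_mem_right _ _ (Ideal.mem_map_of_mem _ ?_)
    have := norm_coeff_lt_one h1 (n := i) (by rw [hdeg]; exact Finset.mem_range.1 hi)
    rw [hq, Polynomial.coeff_map] at this
    rw [IsLocalRing.mem_maximalIdeal, PadicInt.mem_nonunits]
    exact this
  rw [PadicInt.maximalIdeal_eq_span_p, Ideal.map_span, Set.image_singleton, map_natCast,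
    Ideal.mem_span_singleton] at hmem
  obtain ⟨z, hz⟩ := hmem
  exact ⟨z, z.2, by simpa using congrArg Subtype.val hz⟩


lemma norm_lt_one_of_prod {x y : PadicAlgCl p} (hx : ‖x‖ ≤ 1) (hy : ‖y‖ < 1) : ‖x * y‖ < 1 := by
  rw [norm_mul]
  nlinarith [norm_nonneg x, norm_nonneg y]

/-- The maximal ideal of the integral closure of `ℤ_p` in the algebraic closure of `ℚ_p`. -/
def maxIdeal (p : ℕ) [Fact p.Prime] : Ideal (integralClosure ℤ_[p] (PadicAlgCl p)) where
  carrier := {x | ‖(x : PadicAlgCl p)‖ < 1}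
  zero_mem' := by simp
  add_mem' {a b} ha hb :=
    (PadicAlgCl.isNonarchimedean p a b).trans_lt (max_lt ha hb)
  smul_mem' c x hx := norm_lt_one_of_prod (norm_le_one_of_isIntegral c.2) hx

lemma mem_maxIdeal {x : integralClosure ℤ_[p] (PadicAlgCl p)} :
    x ∈ maxIdeal p ↔ ‖(x : PadicAlgCl p)‖ < 1 := Iff.rfl

instance : (maxIdeal p).IsPrime := by
  refine ⟨fun h => ?_, fun {x y} h => ?_⟩
  · have := (Ideal.eq_top_iff_one _).1 h
    rw [mem_maxIdeal] at this
    simp at this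
  · by_contra! hc
    simp only [mem_maxIdeal, not_lt] at hc h
    have : (1:ℝ) ≤ ‖(x : PadicAlgCl p)‖ * ‖(y : PadicAlgCl p)‖ := one_le_mul_of_one_le_of_one_le hc.1 hc.2
    rw [← norm_mul] at this
    exact absurd h (not_lt.2 this)

lemma norm_algebraMap (a : ℤ_[p]) : ‖algebraMap ℤ_[p] (PadicAlgCl p) a‖ = ‖a‖ := by
  rw [IsScalarTower.algebraMap_apply ℤ_[p] ℚ_[p] (PadicAlgCl p)]
  exact PadicAlgCl.norm_extends p _

lemma p_mem_maxIdeal : (p : integralClosure ℤ_[p] (PadicAlgCl p)) ∈ maxIdeal p := by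
  rw [mem_maxIdeal]
  have := norm_algebraMap (p := p) p
  rw [map_natCast] at this
  have h2 : (((p : integralClosure ℤ_[p] (PadicAlgCl p))) : PadicAlgCl p) = p := by simp
  rw [h2, this]
  exact by rw [PadicInt.norm_p]; exact inv_lt_one_of_one_lt₀ (by exact_mod_cast (Fact.out : p.Prime).one_lt)

lemma norm_pow_sub_lt (a : ℤ_[p]) : ‖a ^ p - a‖ < 1 := by
  have : a ^ p - a ∈ RingHom.ker (PadicInt.toZMod (p := p)) := by
    rw [RingHom.mem_ker, map_sub, map_pow, ZMod.pow_card, sub_self]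
  rw [PadicInt.ker_toZMod, IsLocalRing.mem_maximalIdeal, PadicInt.mem_nonunits] at this
  exact this

instance : CharP (integralClosure ℤ_[p] (PadicAlgCl p) ⧸ maxIdeal p) p := by
  have : Nontrivial (integralClosure ℤ_[p] (PadicAlgCl p) ⧸ maxIdeal p) :=
    Ideal.Quotient.nontrivial_iff.2 (Ideal.IsPrime.ne_top inferInstance)
  rw [CharP.charP_iff_prime_eq_zero Fact.out]
  exact Ideal.Quotient.eq_zero_iff_mem.2 p_mem_maxIdeal

instance : Algebra.IsInvariant ℤ_[p] (integralClosure ℤ_[p] (PadicAlgCl p))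
    Gal(PadicAlgCl p/ℚ_[p]) where
  isInvariant b hb := by
    have h1 : (b : PadicAlgCl p) ∈ (⊥ : IntermediateField ℚ_[p] (PadicAlgCl p)) := by
      rw [InfiniteGalois.mem_bot_iff_fixed]
      intro σ
      exact congrArg Subtype.val (hb σ)
    obtain ⟨c, hc⟩ := IntermediateField.mem_bot.1 h1
    have h2 : IsIntegral ℤ_[p] c := by
      have := b.2
      rw [← hc] at this
      exact (isIntegral_algebraMap_iff (algebraMap ℚ_[p] (PadicAlgCl p)).injective).1 this
    obtain ⟨a, ha⟩ := IsIntegrallyClosed.isIntegral_iff.1 h2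
    refine ⟨a, Subtype.val_injective ?_⟩
    rw [← hc, ← ha]
    exact IsScalarTower.algebraMap_apply ℤ_[p] ℚ_[p] (PadicAlgCl p) a

lemma exists_galois_frobenius : ∃ σ : Gal(PadicAlgCl p/ℚ_[p]),
    ∀ x : PadicAlgCl p, IsIntegral ℤ_[p] x → ‖σ x - x ^ p‖ < 1 := by
  let B := integralClosure ℤ_[p] (PadicAlgCl p)
  let Q : Ideal B := maxIdeal p
  let P : Ideal ℤ_[p] := Q.under ℤ_[p]
  let _ : TopologicalSpace B := ⊥
  have : DiscreteTopology B := ⟨rfl⟩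
  have : ContinuousSMul Gal(PadicAlgCl p/ℚ_[p]) B := by
    rw [continuousSMul_iff_stabilizer_isOpen]
    intro x
    convert stabilizer_isOpen_of_isIntegral (K := ℚ_[p]) (x : PadicAlgCl p) using 1
    ext g
    exact Subtype.ext_iff
  have hbij : Function.Bijective (frobenius (B ⧸ Q) p) := by
    refine ⟨frobenius_inj _ p, fun x => ?_⟩
    obtain ⟨x, rfl⟩ := Ideal.Quotient.mk_surjective x
    obtain ⟨y, hy⟩ := IsAlgClosed.exists_pow_nat_eq (x : PadicAlgCl p)
      (Fact.out : p.Prime).pos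
    have hyi : IsIntegral ℤ_[p] y := by
      refine IsIntegral.of_pow (Fact.out : p.Prime).pos ?_
      rw [hy]; exact x.2
    refine ⟨Ideal.Quotient.mk Q ⟨y, hyi⟩, ?_⟩
    rw [frobenius_def, ← map_pow]
    congr 1
    exact Subtype.ext hy
  let F : (B ⧸ Q) ≃ₐ[ℤ_[p] ⧸ P] (B ⧸ Q) :=
    AlgEquiv.ofRingEquiv (f := RingEquiv.ofBijective _ hbij) (by
      intro r
      obtain ⟨a, rfl⟩ := Ideal.Quotient.mk_surjective r
      change (Ideal.Quotient.mk Q (algebraMap ℤ_[p] B a)) ^ p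
        = Ideal.Quotient.mk Q (algebraMap ℤ_[p] B a)
      rw [← map_pow, Ideal.Quotient.eq, ← map_pow, ← map_sub, mem_maxIdeal]
      exact (norm_algebraMap _).trans_lt (norm_pow_sub_lt a))
  obtain ⟨σ, hσ⟩ := Ideal.Quotient.stabilizerHom_surjective_of_profinite
    (G := Gal(PadicAlgCl p/ℚ_[p])) P Q F
  refine ⟨σ.1, fun x hx => ?_⟩
  have := congrArg (fun e => e (Ideal.Quotient.mk Q ⟨x, hx⟩)) hσ
  change Ideal.Quotient.mk Q (σ.1 • ⟨x, hx⟩) = (Ideal.Quotient.mk Q ⟨x, hx⟩) ^ p at this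
  rw [← map_pow, Ideal.Quotient.eq, mem_maxIdeal] at this
  exact this

/-- The ring `ℤ_p^ur` has an endomorphism lifting the `p`-power Frobenius. -/
theorem exists_frobenius_Zur : ∃ φ : Zur p →+* Zur p, ∀ x, (p : Zur p) ∣ φ x - x ^ p := by
  obtain ⟨σ, hσ⟩ := exists_galois_frobenius (p := p)
  let τ : PadicAlgCl p →ₐ[ℤ_[p]] PadicAlgCl p := (σ : PadicAlgCl p →ₐ[ℚ_[p]] PadicAlgCl p).restrictScalars ℤ_[p]
  have hτ : ∀ x ∈ Zur p, τ x ∈ Zur p := by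
    intro x hx
    obtain ⟨S, hS, hxS⟩ := mem_Zur.1 hx
    exact mem_Zur.2 ⟨S.map τ, hS.map τ, ⟨x, hxS, rfl⟩⟩
  refine ⟨((τ.comp (Zur p).val).codRestrict (Zur p) fun x => hτ x x.2).toRingHom, fun x => ?_⟩
  obtain ⟨S, hS, hxS⟩ := mem_Zur.1 x.2
  have hT := hS.sup (hS.map τ)
  have h1 : τ x ∈ S ⊔ S.map τ := (le_sup_right : S.map τ ≤ _) ⟨x, hxS, rfl⟩
  have h2 : (x : PadicAlgCl p) ∈ S ⊔ S.map τ := (le_sup_left : S ≤ _) hxS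
  obtain ⟨z, hz, hz'⟩ := exists_eq_p_mul hT (sub_mem h1 (pow_mem h2 p))
    (hσ x (isIntegral_of_mem hS hxS))
  refine ⟨⟨z, mem_Zur.2 ⟨_, hT, hz⟩⟩, Subtype.ext ?_⟩
  exact hz'.trans (by simp)


open AdicCompletion in
lemma exists_coherent {A : Type*} [CommRing A] (I : Ideal A) (x : AdicCompletion I A) :
    ∃ a : ℕ → A, (∀ n, evalₐ I n x = Ideal.Quotient.mk _ (a n)) ∧
      ∀ m n, m ≤ n → evalₐ I m x = Ideal.Quotient.mk _ (a n) := by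
  induction x using AdicCompletion.induction_on with
  | h a => exact ⟨a, fun n => evalₐ_mk I n a, fun m n hmn => by
      rw [evalₐ_mk]; exact (AdicCompletion.Ideal.mk_eq_mk I hmn a).symm⟩

open AdicCompletion in
lemma exists_frobenius_adicCompletion {A : Type*} [CommRing A] {q : ℕ} (φ : A →+* A)
    (hφ : ∀ x, (q : A) ∣ φ x - x ^ q) :
    ∃ ψ : AdicCompletion (Ideal.span {(q : A)}) A →+* AdicCompletion (Ideal.span {(q : A)}) A,
      ∀ x, (q : AdicCompletion (Ideal.span {(q : A)}) A) ∣ ψ x - x ^ q := by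
  let I : Ideal A := Ideal.span {(q : A)}
  have hI : ∀ n, I ^ n ≤ (I ^ n).comap φ := fun n => by
    rw [Ideal.span_singleton_pow, Ideal.span_le, Set.singleton_subset_iff]
    simp
  let f : (n : ℕ) → AdicCompletion I A →+* A ⧸ I ^ n := fun n =>
    (Ideal.quotientMap (I ^ n) φ (hI n)).comp (evalₐ I n : AdicCompletion I A →+* A ⧸ I ^ n)
  have key : ∀ n (x : AdicCompletion I A) (a : A), evalₐ I n x = Ideal.Quotient.mk _ a →
      f n x = Ideal.Quotient.mk _ (φ a) := by
    intro n x a h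
    change Ideal.quotientMap (I ^ n) φ (hI n) (evalₐ I n x) = _
    rw [h, Ideal.quotientMap_mk]
  have hf : ∀ {m n : ℕ} (hle : m ≤ n), (Ideal.Quotient.factorPow I hle).comp (f n) = f m := by
    intro m n hle
    ext x
    obtain ⟨a, ha, ha'⟩ := exists_coherent I x
    rw [RingHom.comp_apply, key n x _ (ha n), key m x _ (ha' m n hle)]
    rfl
  refine ⟨AdicCompletion.liftRingHom I f hf, fun x => ?_⟩
  set y := AdicCompletion.liftRingHom I f hf x - x ^ q
  have hy : evalₐ I 1 y = 0 := by
    obtain ⟨a, ha⟩ := Ideal.Quotient.mk_surjective (evalₐ I 1 x)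
    rw [map_sub, map_pow, evalₐ_liftRingHom, key 1 x a ha.symm, ← ha, ← map_pow, ← map_sub,
      Ideal.Quotient.eq_zero_iff_mem, pow_one, Ideal.mem_span_singleton]
    exact hφ a
  have hy2 : y ∈ RingHom.ker (evalOneₐ I).toRingHom := by
    rw [RingHom.mem_ker]
    change evalOneₐ I y = 0
    rw [← factorₐ_evalₐ_one, hy, _root_.map_zero]
  rw [ker_evalOneₐ_eq_map I ⟨{(q : A)}, by simp [I]⟩, Ideal.map_span, Set.image_singleton,
    map_natCast, Ideal.mem_span_singleton] at hy2
  exact hy2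

open AdicCompletion in
lemma adicCompletion_torsionFree {A : Type*} [CommRing A] [IsDomain A] {q : ℕ} (hq : (q : A) ≠ 0)
    {x : AdicCompletion (Ideal.span {(q : A)}) A} (hx : q * x = 0) : x = 0 := by
  refine AdicCompletion.ext_evalₐ fun n => ?_
  obtain ⟨a, ha, ha'⟩ := exists_coherent _ x
  have h1 := congrArg (evalₐ _ (n + 1)) hx
  rw [map_mul, map_natCast, ha, _root_.map_zero, ← map_natCast (Ideal.Quotient.mk _), ← map_mul,
    Ideal.Quotient.eq_zero_iff_mem, Ideal.span_singleton_pow, Ideal.mem_span_singleton,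
    pow_succ', mul_dvd_mul_iff_left hq] at h1
  rw [ha' n (n + 1) n.le_succ, _root_.map_zero, Ideal.Quotient.eq_zero_iff_mem,
    Ideal.span_singleton_pow, Ideal.mem_span_singleton]
  exact h1

lemma natCast_Zur_ne_zero : (p : Zur p) ≠ 0 := by
  intro h
  have h2 : (p : PadicAlgCl p) = 0 := by simpa using congrArg Subtype.val h
  exact (Fact.out : p.Prime).ne_zero (by exact_mod_cast h2)

end UnramifiedExtension

section BaseRing

variable (p : ℕ) [Fact p.Prime]

/-- The ring `R`: the `p`-adic completion of `ℤ_p^ur`. -/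
def R : Type := AdicCompletion (Ideal.span {(p : Zur p)}) (Zur p)

instance : CommRing (R p) :=
  inferInstanceAs (CommRing (AdicCompletion (Ideal.span {(p : Zur p)}) (Zur p)))

theorem exists_frobenius : ∃ φ : R p →+* R p, ∀ a, (p : R p) ∣ φ a - a ^ p := by
  obtain ⟨φ, hφ⟩ := exists_frobenius_Zur (p := p)
  exact exists_frobenius_adicCompletion φ hφ

/-- The ring endomorphism `φ` of `R` lifting the `p`-power Frobenius of `R / p R`
(there is exactly one). -/
def frob : R p →+* R p := (exists_frobenius p).choose

variable {p}

theorem dvd_frob_sub_pow (a : R p) : (p : R p) ∣ frob p a - a ^ p :=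
  (exists_frobenius p).choose_spec a

theorem eq_zero_of_natCast_mul {a : R p} (h : p * a = 0) : a = 0 :=
  adicCompletion_torsionFree natCast_Zur_ne_zero h

end BaseRing

section DeltaPolynomials

variable (p : ℕ) [Fact p.Prime] (N : ℕ)

/-- The `δ`-polynomial ring `R{x} = R[x, x', x'', …]` in an `N`-tuple of variables `x`:
the variable with index `(j, i)` is the `i`-th derivative `x_j^(i)`. -/
abbrev DeltaPoly : Type := MvPolynomial (Fin N × ℕ) (R p)

/-- The lift of Frobenius `φ` of `R{x}` which extends that of `R` and sends
`x^(i)` to `(x^(i))^p + p x^(i+1)`. -/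
def polyFrob : DeltaPoly p N →+* DeltaPoly p N :=
  MvPolynomial.eval₂Hom (MvPolynomial.C.comp (frob p))
    fun v => MvPolynomial.X v ^ p + (p : DeltaPoly p N) * MvPolynomial.X (v.1, v.2 + 1)

variable {p N}

theorem dvd_polyFrob_sub_pow (f : DeltaPoly p N) : (p : DeltaPoly p N) ∣ polyFrob p N f - f ^ p := by
  induction f using MvPolynomial.induction_on with
  | C a =>
    obtain ⟨b, hb⟩ := dvd_frob_sub_pow a
    refine ⟨MvPolynomial.C b, ?_⟩
    have := congrArg (MvPolynomial.C (σ := Fin N × ℕ)) hb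
    simpa [polyFrob] using this
  | add f g hf hg =>
    obtain ⟨r, hr⟩ := exists_add_pow_prime_eq (Fact.out : p.Prime) f g
    have e : polyFrob p N (f + g) - (f + g) ^ p =
        (polyFrob p N f - f ^ p) + (polyFrob p N g - g ^ p) -
          (p : DeltaPoly p N) * (f * g * r) := by
      rw [hr, map_add]; ring
    rw [e]
    exact dvd_sub (dvd_add hf hg) (dvd_mul_right _ _)
  | mul_X f v hf =>
    have e : polyFrob p N (f * MvPolynomial.X v) - (f * MvPolynomial.X v) ^ p =
        (polyFrob p N f - f ^ p) * MvPolynomial.X v ^ p +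
          (p : DeltaPoly p N) * (polyFrob p N f * MvPolynomial.X (v.1, v.2 + 1)) := by
      have : polyFrob p N (MvPolynomial.X v) =
          MvPolynomial.X v ^ p + (p : DeltaPoly p N) * MvPolynomial.X (v.1, v.2 + 1) := by
        simp [polyFrob]
      rw [map_mul, this]; ring
    rw [e]
    exact dvd_add (hf.mul_right _) (dvd_mul_right _ _)

/-- The `p`-derivation `δ f = (φ(f) - f^p) / p` of `R{x}`. -/
def delta (f : DeltaPoly p N) : DeltaPoly p N := (dvd_polyFrob_sub_pow f).choose

theorem natCast_mul_delta (f : DeltaPoly p N) :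
    (p : DeltaPoly p N) * delta f = polyFrob p N f - f ^ p :=
  (dvd_polyFrob_sub_pow f).choose_spec.symm

theorem coeff_natCast_mul (f : DeltaPoly p N) (m : Fin N × ℕ →₀ ℕ) :
    ((p : DeltaPoly p N) * f).coeff m = p * f.coeff m := by
  rw [← map_natCast (MvPolynomial.C : R p →+* DeltaPoly p N), MvPolynomial.coeff_C_mul]

theorem DeltaPoly.eq_of_natCast_mul {f g : DeltaPoly p N}
    (h : (p : DeltaPoly p N) * f = p * g) : f = g := by
  refine MvPolynomial.ext _ _ fun m => sub_eq_zero.1 (eq_zero_of_natCast_mul ?_)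
  rw [mul_sub, ← coeff_natCast_mul, ← coeff_natCast_mul, h, sub_self]

theorem delta_X (v : Fin N × ℕ) :
    delta (MvPolynomial.X v : DeltaPoly p N) = MvPolynomial.X (v.1, v.2 + 1) := by
  apply DeltaPoly.eq_of_natCast_mul
  rw [natCast_mul_delta]
  simp [polyFrob]

variable (p N) in
/-- The subring `R[x, x', …, x^(n)]` of `R{x}`. -/
abbrev truncation (n : ℕ) : Subalgebra (R p) (DeltaPoly p N) :=
  MvPolynomial.supported (R p) {v : Fin N × ℕ | v.2 ≤ n}

theorem truncation_mono {m n : ℕ} (h : m ≤ n) : truncation p N m ≤ truncation p N n :=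
  MvPolynomial.supported_mono fun _ hv => le_trans hv h

theorem X_mem_truncation {n : ℕ} {v : Fin N × ℕ} (hv : v.2 ≤ n) :
    (MvPolynomial.X v : DeltaPoly p N) ∈ truncation p N n :=
  Algebra.subset_adjoin (Set.mem_image_of_mem _ hv)

theorem polyFrob_mem {n : ℕ} {f : DeltaPoly p N} (hf : f ∈ truncation p N n) :
    polyFrob p N f ∈ truncation p N (n + 1) := by
  induction hf using Algebra.adjoin_induction with
  | mem f hf =>
    obtain ⟨v, hv, rfl⟩ := hf
    have : polyFrob p N (MvPolynomial.X v) =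
        MvPolynomial.X v ^ p + (p : DeltaPoly p N) * MvPolynomial.X (v.1, v.2 + 1) := by
      simp [polyFrob]
    rw [this]
    exact add_mem (pow_mem (X_mem_truncation (le_trans hv n.le_succ)) _)
      (mul_mem (natCast_mem _ _) (X_mem_truncation (Nat.succ_le_succ hv)))
  | algebraMap r =>
    have : polyFrob p N (algebraMap (R p) _ r) = algebraMap (R p) _ (frob p r) := by
      simp [polyFrob, MvPolynomial.algebraMap_eq]
    rw [this]
    exact Subalgebra.algebraMap_mem _ _
  | add f g _ _ hf hg => rw [map_add]; exact add_mem hf hg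
  | mul f g _ _ hf hg => rw [map_mul]; exact mul_mem hf hg

theorem delta_mem {n : ℕ} {f : DeltaPoly p N} (hf : f ∈ truncation p N n) :
    delta f ∈ truncation p N (n + 1) := by
  have h : (p : DeltaPoly p N) * delta f ∈ truncation p N (n + 1) := by
    rw [natCast_mul_delta]
    exact sub_mem (polyFrob_mem hf) (pow_mem (truncation_mono n.le_succ hf) _)
  rw [MvPolynomial.mem_supported] at h ⊢
  refine subset_trans (fun v hv => ?_) h
  rw [Finset.mem_coe, MvPolynomial.mem_vars_iff_mem_support] at hv ⊢
  obtain ⟨m, hm, hv⟩ := hv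
  refine ⟨m, ?_, hv⟩
  rw [MvPolynomial.mem_support_iff] at hm ⊢
  rw [coeff_natCast_mul]
  exact fun h0 => hm (eq_zero_of_natCast_mul h0)

/-- The inclusion of the polynomial ring `R[x]` in `R{x}`. -/
def ofPoly (f : MvPolynomial (Fin N) (R p)) : DeltaPoly p N :=
  MvPolynomial.rename (fun j => (j, 0)) f

theorem iterate_delta_mem (f : MvPolynomial (Fin N) (R p)) {i n : ℕ} (h : i ≤ n) :
    delta^[i] (ofPoly f) ∈ truncation p N n := by
  refine truncation_mono h ?_
  clear h
  induction i with
  | zero =>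
    change MvPolynomial.rename (fun j => (j, 0)) f ∈ _
    induction f using MvPolynomial.induction_on with
    | C a => rw [MvPolynomial.rename_C]; exact Subalgebra.algebraMap_mem _ a
    | add f g hf hg => rw [map_add]; exact add_mem hf hg
    | mul_X f j hf =>
      rw [map_mul, MvPolynomial.rename_X]
      exact mul_mem hf (X_mem_truncation le_rfl)
  | succ i ih =>
    rw [Function.iterate_succ_apply']
    exact delta_mem ih

end DeltaPolynomials

section JetSpaces

variable {p : ℕ} [Fact p.Prime] {N M : ℕ}

variable (p N) in
/-- The `p`-adic completion of `R[x, x', …, x^(n)]`. -/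
abbrev completedTruncation (n : ℕ) : Type :=
  AdicCompletion (Ideal.span {(p : truncation p N n)}) (truncation p N n)

/-- The ideal `(f, δ f, …, δ^n f)` of the `p`-adic completion of `R[x, x', …, x^(n)]`. -/
def jetIdeal (f : Fin M → MvPolynomial (Fin N) (R p)) (n : ℕ) :
    Ideal (completedTruncation p N n) :=
  Ideal.span (Set.range fun v : Fin M × Fin (n + 1) =>
    algebraMap (truncation p N n) (completedTruncation p N n)
      ⟨delta^[(v.2 : ℕ)] (ofPoly (f v.1)), iterate_delta_mem _ (Nat.lt_succ_iff.1 v.2.isLt)⟩)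

/-- The ring `𝒪^n(X)` of global functions on the `p`-jet space `J^n(X)` of the affine scheme of
finite type `X = Spec R[x] / (f)`, where `x` and `f` are finite tuples:
`J^n(X)` is the formal spectrum of `R[x, x', …, x^(n)]^ / (f, δ f, …, δ^n f)`. -/
abbrev JetRing (f : Fin M → MvPolynomial (Fin N) (R p)) (n : ℕ) : Type :=
  completedTruncation p N n ⧸ jetIdeal f n

variable (p) in
/-- The equation `x^(p^ν) - 1` of the group scheme `μ_{p^ν} = Spec R[x] / (x^(p^ν) - 1)`. -/
def muEquation (ν : ℕ) : Fin 1 → MvPolynomial (Fin 1) (R p) :=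
  fun _ => MvPolynomial.X 0 ^ p ^ ν - 1

variable (p) in
/-- The ring `𝒪^n(μ_{p^ν})` of global functions on the `n`-th `p`-jet space of `μ_{p^ν}`. -/
abbrev MuJetRing (n ν : ℕ) : Type := JetRing (muEquation p ν) n

end JetSpaces

end PJet

end

noncomputable section

namespace PJet

open Polynomial

/-! ### Binomial expansions modulo powers of an odd prime -/

section BinomialExpansions

variable {A : Type*} [CommRing A]

/-! Equip `R[t]` with the Frobenius lift `t ↦ t^p`, so `δ t = 0`. Each `u ∈ R[t]` gives a map of
`δ`-rings `R{x} → R[t]`, `x^(i) ↦ δ^i u`. If an ideal `J ∋ p` contains `δ^i (u^(p^ν) - 1)` for `i ≤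
n`, this induces a ring map `𝒪^n(μ_{p^ν}) → R[t]/J` (`exists_muJetRing_point`). Both claims come
from a choice of `u` and `J`.

Not finite: `u = 1 + p^n t`, `J = (p)`. For `p` odd and `ν ≥ 1`, `u^(p^ν) - 1` is divisible by
`p^(n+1)`, and each `δ` costs one factor `p`, so all the equations hold mod `p`. Yet `δ^n u ≡
t^(p^n)` mod `p`, so the image of `x^(n)` is not integral over `R`.

Not flat: expanding `p δ(x^(p^ν) - 1) = 0` gives `p^(ν+1) x' (x^(p(p^ν-1)) + p c) = 0`
(`exists_torsion_muJetRing`). Flatness would cancel `p^(ν+1)`. But for `u = 1 + p t` and `J = (p,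
t^(p^2))` the remaining factor maps to `t^p ∉ J`. -/

theorem add_natCast_mul_pow_prime {p : ℕ} (hp : p.Prime) (h2 : p ≠ 2) (a b : A) :
    ∃ c, (a + p * b) ^ p = a ^ p + p ^ 2 * b * a ^ (p - 1) + p ^ 3 * b ^ 2 * c := by
  have h3 : 3 ≤ p := by have := hp.two_le; omega
  obtain ⟨k, rfl⟩ : ∃ k, p = k + 2 := ⟨p - 2, by omega⟩
  set p := k + 2 with hk
  have hd : ∀ i ∈ Finset.range (k + 1), (p : A) ^ 3 * b ^ 2 ∣
      (p * b) ^ (i + 2) * a ^ (p - (i + 2)) * (p.choose (i + 2) : A) := by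
    intro i hi
    rw [Finset.mem_range] at hi
    -- The top term `(p b)^p` contains `p^3` because `p ≥ 3`; in the others the third factor `p`
    -- comes from the binomial coefficient.
    rcases eq_or_ne (i + 2) p with h | h
    · obtain ⟨j, rfl⟩ : ∃ j, i = j + 1 := ⟨i - 1, by omega⟩
      exact ⟨p ^ j * b ^ (j + 1) * a ^ (p - (j + 1 + 2)) * (p.choose (j + 1 + 2) : A), by ring⟩
    · obtain ⟨e, he⟩ := hp.dvd_choose_self (k := i + 2) (by omega) (by omega)
      rw [he]
      exact ⟨p ^ i * b ^ i * a ^ (p - (i + 2)) * e, by push_cast; ring⟩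
  obtain ⟨c, hc⟩ := Finset.dvd_sum hd
  refine ⟨c, ?_⟩
  rw [← hc, add_comm a, add_pow, hk, Finset.sum_range_succ', Finset.sum_range_succ', ← hk]
  simp
  ring

/-- Raising to the `p`-th power multiplies the perturbation by `p` to leading order. Keeping `b` as
an explicit factor allows the step from `ν` to `ν + 1` to reuse the case of a single `p`-th power.
-/
theorem add_natCast_mul_pow_prime_pow {p : ℕ} (hp : p.Prime) (h2 : p ≠ 2) (a b : A) (ν : ℕ) :
    ∃ c, (a + p * b) ^ p ^ ν = a ^ p ^ ν + p ^ (ν + 1) * b * (a ^ (p ^ ν - 1) + p * c) := by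
  induction ν with
  | zero => exact ⟨0, by simp⟩
  | succ ν ih =>
    obtain ⟨c, hc⟩ := ih
    obtain ⟨d, hd⟩ := add_natCast_mul_pow_prime hp h2 (a ^ p ^ ν)
      (p ^ ν * b * (a ^ (p ^ ν - 1) + p * c))
    refine ⟨c * (a ^ p ^ ν) ^ (p - 1) + p ^ ν * b * (a ^ (p ^ ν - 1) + p * c) ^ 2 * d, ?_⟩
    have e : a ^ (p ^ (ν + 1) - 1) = a ^ (p ^ ν - 1) * (a ^ p ^ ν) ^ (p - 1) := by
      rw [← pow_mul, ← pow_add, pow_succ, Nat.mul_sub, mul_one]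
      congr 1
      have := Nat.le_mul_of_pos_right (p ^ ν) hp.pos
      have := Nat.pow_pos (n := ν) hp.pos
      omega
    have e' : a ^ p ^ ν + p ^ (ν + 1) * b * (a ^ (p ^ ν - 1) + p * c) =
        a ^ p ^ ν + p * (p ^ ν * b * (a ^ (p ^ ν - 1) + p * c)) := by ring
    rw [e, pow_succ p ν, pow_mul, hc, e', hd, pow_mul a]
    ring

end BinomialExpansions

variable {p : ℕ} [Fact p.Prime]

/-- An inverse of `p` would reduce to one modulo `p`, hence `p` would divide `1` in `ℤ_p^ur`; but
elements there have norm at most `1`, while `‖p‖ < 1`. -/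
theorem not_natCast_dvd_one : ¬ (p : R p) ∣ 1 := by
  rintro ⟨a, ha⟩
  have h1 := congrArg (AdicCompletion.evalₐ (Ideal.span {(p : Zur p)}) 1) ha
  obtain ⟨b, hb⟩ := Ideal.Quotient.mk_surjective
    (AdicCompletion.evalₐ (Ideal.span {(p : Zur p)}) 1 a)
  have h2 : Ideal.Quotient.mk (Ideal.span {(p : Zur p)} ^ 1) 1 = Ideal.Quotient.mk _ (p * b) := by
    rw [map_one, map_mul, hb, map_natCast]
    refine (map_one (AdicCompletion.evalₐ (Ideal.span {(p : Zur p)}) 1)).symm.trans (h1.trans ?_)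
    refine (map_mul (AdicCompletion.evalₐ (Ideal.span {(p : Zur p)}) 1) _ _).trans ?_
    congr 1
  rw [Ideal.Quotient.eq, pow_one, Ideal.mem_span_singleton] at h2
  obtain ⟨z, hz⟩ : (p : Zur p) ∣ 1 := (dvd_sub_left (dvd_mul_right _ _)).1 h2
  obtain ⟨S, hS, hzS⟩ := mem_Zur.1 z.2
  have hz1 := norm_le_one_of_isIntegral (isIntegral_of_mem hS hzS)
  have hp1 := mem_maxIdeal.1 (p_mem_maxIdeal (p := p))
  have := norm_lt_one_of_prod hz1 hp1
  have hz' : (z : PadicAlgCl p) * p = 1 := by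
    rw [mul_comm]; simpa using (congrArg Subtype.val hz).symm
  simp [hz'] at this

/-! ### The `δ`-structure on `R[t]` with `δ t = 0` -/

section PolynomialFrobenius

variable (p) in
/-- The lift of Frobenius of `R[t]` which extends that of `R` and sends `t` to `t^p`. -/
def tFrob : (R p)[X] →+* (R p)[X] := eval₂RingHom (C.comp (frob p)) (X ^ p)

@[simp] theorem tFrob_C (a : R p) : tFrob p (C a) = C (frob p a) := by simp [tFrob]

@[simp] theorem tFrob_X : tFrob p X = X ^ p := by simp [tFrob]

theorem dvd_tFrob_sub_pow (f : (R p)[X]) : (p : (R p)[X]) ∣ tFrob p f - f ^ p := by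
  induction f using Polynomial.induction_on with
  | C a =>
    obtain ⟨b, hb⟩ := dvd_frob_sub_pow a
    exact ⟨C b, by simpa using congrArg C hb⟩
  | add f g hf hg =>
    obtain ⟨r, hr⟩ := exists_add_pow_prime_eq (Fact.out : p.Prime) f g
    have e : tFrob p (f + g) - (f + g) ^ p =
        (tFrob p f - f ^ p) + (tFrob p g - g ^ p) - (p : (R p)[X]) * (f * g * r) := by
      rw [hr, map_add]; ring
    rw [e]
    exact dvd_sub (dvd_add hf hg) (dvd_mul_right _ _)
  | monomial n a hf =>
    have e : tFrob p (C a * X ^ (n + 1)) - (C a * X ^ (n + 1)) ^ p =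
        (tFrob p (C a * X ^ n) - (C a * X ^ n) ^ p) * X ^ p := by
      simp only [map_mul, map_pow, tFrob_X]; ring
    rw [e]
    exact hf.mul_right _

/-- The `p`-derivation of `R[t]` with `δ t = 0`. -/
def tDelta (f : (R p)[X]) : (R p)[X] := (dvd_tFrob_sub_pow f).choose

theorem natCast_mul_tDelta (f : (R p)[X]) : (p : (R p)[X]) * tDelta f = tFrob p f - f ^ p :=
  (dvd_tFrob_sub_pow f).choose_spec.symm

theorem eq_of_natCast_mul {f g : (R p)[X]} (h : (p : (R p)[X]) * f = p * g) : f = g := by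
  refine Polynomial.ext fun m => sub_eq_zero.1 (eq_zero_of_natCast_mul ?_)
  have := congrArg (coeff · m) h
  simp only [Polynomial.coeff_natCast_mul] at this
  rw [mul_sub, this, sub_self]

/-- Dividing `φ(p^(m+1) f)` by `p` leaves `p^m φ(f)`, while the `p`-th power contributes only higher
order. So `δ` strips one factor `p` and acts as Frobenius on the leading term. -/
theorem tDelta_natCast_pow_mul (m : ℕ) (f : (R p)[X]) :
    ∃ g : (R p)[X], tDelta ((p : (R p)[X]) ^ (m + 1) * f) =
      (p : (R p)[X]) ^ m * (tFrob p f + (p : (R p)[X]) * g) := by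
  -- `k` is the surplus of `p`'s in `(p^(m+1) f)^p` beyond the `m + 2` that the claim uses: one
  -- removed by `δ`, `m` outside the bracket and one in front of `g`.
  obtain ⟨k, hk⟩ : ∃ k, (m + 1) * p = m + 2 + k :=
    Nat.exists_eq_add_of_le (by nlinarith [(Fact.out : p.Prime).two_le])
  refine ⟨-(p ^ k * f ^ p), eq_of_natCast_mul ?_⟩
  rw [natCast_mul_tDelta, mul_pow, ← pow_mul, hk]
  simp only [map_mul, map_pow, map_natCast]
  ring

theorem tDelta_X_pow_mul (k : ℕ) (f : (R p)[X]) : tDelta (X ^ k * f) = X ^ (k * p) * tDelta f := by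
  apply eq_of_natCast_mul
  rw [mul_left_comm, natCast_mul_tDelta, natCast_mul_tDelta]
  simp only [map_mul, map_pow, tFrob_X]
  ring

theorem dvd_iterate_tDelta (i : ℕ) : ∀ (m : ℕ) {f : (R p)[X]}, (p : (R p)[X]) ^ (m + i) ∣ f →
    (p : (R p)[X]) ^ m ∣ tDelta^[i] f := by
  induction i with
  | zero => exact fun m f h => h
  | succ i ih =>
    rintro m f ⟨g, rfl⟩
    obtain ⟨h, hh⟩ := tDelta_natCast_pow_mul (m + i) g
    rw [Function.iterate_succ_apply, ← add_assoc, hh]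
    exact ih m (dvd_mul_right _ _)

theorem X_pow_dvd_iterate_tDelta (i k : ℕ) {f : (R p)[X]} (h : X ^ k ∣ f) :
    X ^ k ∣ tDelta^[i] f := by
  induction i with
  | zero => exact h
  | succ i ih =>
    obtain ⟨g, hg⟩ := ih
    rw [Function.iterate_succ_apply', hg, tDelta_X_pow_mul]
    exact (pow_dvd_pow _ (Nat.le_mul_of_pos_right k (Fact.out : p.Prime).pos)).mul_right _

theorem tDelta_one_add (hp : p ≠ 2) (m : ℕ) (f : (R p)[X]) :
    ∃ g : (R p)[X], tDelta (1 + (p : (R p)[X]) ^ (m + 1) * f) =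
      (p : (R p)[X]) ^ m * (tFrob p f + (p : (R p)[X]) * g) := by
  obtain ⟨c, hc⟩ := add_natCast_mul_pow_prime_pow (Fact.out : p.Prime) hp 1
    ((p : (R p)[X]) ^ m * f) 1
  refine ⟨-(f * (1 + p * c)), eq_of_natCast_mul ?_⟩
  simp only [pow_one, one_pow] at hc
  rw [natCast_mul_tDelta, pow_succ', mul_assoc, hc]
  simp only [map_add, map_one, map_mul, map_pow, map_natCast]
  ring

/-- The first `δ` removes the constant `1`; each further one strips a `p` and raises `t` to its
`p`-th power. The spare exponent `m` keeps the induction going; only `m = 0` is used in the end. -/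
theorem iterate_tDelta_one_add (hp : p ≠ 2) (i : ℕ) : ∀ m : ℕ, ∃ g : (R p)[X],
    tDelta^[i + 1] (1 + (p : (R p)[X]) ^ (m + i + 1) * X) =
      (p : (R p)[X]) ^ m * (X ^ p ^ (i + 1) + (p : (R p)[X]) * g) := by
  induction i with
  | zero =>
    intro m
    obtain ⟨g, hg⟩ := tDelta_one_add hp m (X : (R p)[X])
    exact ⟨g, by simpa using hg⟩
  | succ i ih =>
    intro m
    obtain ⟨g, hg⟩ := ih (m + 1)
    obtain ⟨h, hh⟩ := tDelta_natCast_pow_mul m (X ^ p ^ (i + 1) + (p : (R p)[X]) * g)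
    refine ⟨tFrob p g + h, ?_⟩
    rw [show m + (i + 1) + 1 = m + 1 + i + 1 by ring, Function.iterate_succ_apply', hg, hh]
    simp only [map_add, map_mul, map_pow, map_natCast, tFrob_X]
    ring

end PolynomialFrobenius

/-! ### Points of the jet space with values in quotients of `R[t]` -/

section PointsOfJetSpaces

/-- The homomorphism of `δ`-rings `R{x} → R[t]` with `x ↦ u`. -/
def deltaEval (u : (R p)[X]) : DeltaPoly p 1 →ₐ[R p] (R p)[X] :=
  MvPolynomial.aeval fun v => tDelta^[v.2] u

theorem deltaEval_X (u : (R p)[X]) (v : Fin 1 × ℕ) :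
    deltaEval u (MvPolynomial.X v) = tDelta^[v.2] u := by simp [deltaEval]

theorem deltaEval_polyFrob (u : (R p)[X]) (f : DeltaPoly p 1) :
    deltaEval u (polyFrob p 1 f) = tFrob p (deltaEval u f) := by
  induction f using MvPolynomial.induction_on with
  | C a => simp [polyFrob, deltaEval, Polynomial.algebraMap_eq]
  | add f g hf hg => simp only [map_add, hf, hg]
  | mul_X f v hf =>
    have e : polyFrob p 1 (MvPolynomial.X v) =
        MvPolynomial.X v ^ p + (p : DeltaPoly p 1) * MvPolynomial.X (v.1, v.2 + 1) := by
      simp [polyFrob]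
    rw [map_mul, map_mul, map_mul, map_mul, hf, e]
    simp only [map_add, map_pow, map_mul, map_natCast, deltaEval_X, Function.iterate_succ_apply',
      natCast_mul_tDelta]
    ring

theorem deltaEval_delta (u : (R p)[X]) (f : DeltaPoly p 1) :
    deltaEval u (delta f) = tDelta (deltaEval u f) := by
  apply eq_of_natCast_mul
  rw [natCast_mul_tDelta, ← deltaEval_polyFrob, ← map_natCast (deltaEval u), ← map_mul,
    natCast_mul_delta, map_sub, map_pow]

theorem deltaEval_iterate_delta (u : (R p)[X]) (f : DeltaPoly p 1) (i : ℕ) :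
    deltaEval u (delta^[i] f) = tDelta^[i] (deltaEval u f) := by
  induction i with
  | zero => rfl
  | succ i ih => rw [Function.iterate_succ_apply', Function.iterate_succ_apply', deltaEval_delta, ih]

theorem ofPoly_muEquation (ν : ℕ) (j : Fin 1) :
    ofPoly (muEquation p ν j) = (MvPolynomial.X (0, 0) : DeltaPoly p 1) ^ p ^ ν - 1 := by
  simp [ofPoly, muEquation]

/-- The image in `𝒪^n(μ_{p^ν})` of a `δ`-polynomial of order at most `n`. -/
def toMuJetRing (n ν : ℕ) : truncation p 1 n →+* MuJetRing p n ν :=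
  (Ideal.Quotient.mk _).comp (algebraMap (truncation p 1 n) (completedTruncation p 1 n))

theorem algebraMap_muJetRing (n ν : ℕ) (a : R p) :
    algebraMap (R p) (MuJetRing p n ν) a = toMuJetRing n ν (algebraMap (R p) _ a) := rfl

theorem toMuJetRing_iterate_delta {n i : ℕ} (ν : ℕ) (h : i ≤ n) :
    toMuJetRing n ν ⟨delta^[i] (ofPoly (muEquation p ν 0)), iterate_delta_mem _ h⟩ = 0 :=
  Ideal.Quotient.eq_zero_iff_mem.2
    (Ideal.subset_span ⟨(0, ⟨i, Nat.lt_succ_of_le h⟩), rfl⟩)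

/-- Since `p ∈ J`, the evaluation factors through reduction mod `p`, so it extends to the `p`-adic
completion with no convergence argument. `J` need not be stable under `δ`: only the first `n + 1`
equations matter. -/
theorem exists_muJetRing_point {n ν : ℕ} (u : (R p)[X]) {J : Ideal (R p)[X]}
    (hpJ : (p : (R p)[X]) ∈ J) (hu : ∀ i ≤ n, tDelta^[i] (u ^ p ^ ν - 1) ∈ J) :
    ∃ F : MuJetRing p n ν →+* (R p)[X] ⧸ J, ∀ a : truncation p 1 n,
      F (toMuJetRing n ν a) = Ideal.Quotient.mk J (deltaEval u a) := by
  let I : Ideal (truncation p 1 n) := Ideal.span {(p : truncation p 1 n)}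
  let g : truncation p 1 n →+* (R p)[X] ⧸ J := (Ideal.Quotient.mk J).comp
    ((deltaEval u : DeltaPoly p 1 →+* (R p)[X]).comp (truncation p 1 n).subtype)
  have hg : ∀ a ∈ I, g a = 0 := by
    intro a ha
    obtain ⟨b, rfl⟩ := Ideal.mem_span_singleton.1 ha
    rw [map_mul, map_natCast, ← map_natCast (Ideal.Quotient.mk J),
      Ideal.Quotient.eq_zero_iff_mem.2 hpJ, zero_mul]
  let G : completedTruncation p 1 n →+* (R p)[X] ⧸ J :=
    (Ideal.Quotient.lift I g hg).comp (AdicCompletion.evalOneₐ I).toRingHom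
  have hG : ∀ a, G (algebraMap _ _ a) = g a := by
    intro a
    change Ideal.Quotient.lift I g hg (AdicCompletion.evalOneₐ I (algebraMap _ _ a)) = g a
    rw [AlgHom.commutes]
    rfl
  have hJ : ∀ a ∈ jetIdeal (muEquation p ν) n, G a = 0 := by
    intro a ha
    refine (Ideal.span_le (I := RingHom.ker G)).2 ?_ ha
    rintro _ ⟨⟨j, i⟩, rfl⟩
    rw [SetLike.mem_coe, RingHom.mem_ker, hG]
    refine Ideal.Quotient.eq_zero_iff_mem.2 ?_
    change deltaEval u (delta^[(i : ℕ)] (ofPoly (muEquation p ν j))) ∈ J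
    rw [deltaEval_iterate_delta, ofPoly_muEquation]
    simpa [deltaEval_X] using hu i (Nat.lt_succ_iff.1 i.isLt)
  exact ⟨Ideal.Quotient.lift _ G hJ, hG⟩

end PointsOfJetSpaces

/-! ### Non-finiteness -/

theorem natCast_dvd_one_of_dvd_monic {f : (R p)[X]} (hf : f.Monic) (h : (p : (R p)[X]) ∣ f) :
    (p : R p) ∣ 1 := by
  rw [← map_natCast C, C_dvd_iff_dvd_coeff] at h
  simpa [hf.coeff_natDegree] using h f.natDegree

theorem not_finite_muJetRing (hp : p ≠ 2) {n ν : ℕ} (hn : 1 ≤ n) (hν : 1 ≤ ν) :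
    ¬ Module.Finite (R p) (MuJetRing p n ν) := by
  intro hfin
  obtain ⟨k, rfl⟩ : ∃ k, n = k + 1 := ⟨n - 1, by omega⟩
  -- The exponent is `n = k + 1`: `n` applications of `δ` to `u` use up exactly these `p`'s, while
  -- the extra `p` in `u^(p^ν) - 1` keeps its `δ^i` divisible by `p` for `i ≤ n`.
  set u : (R p)[X] := 1 + (p : (R p)[X]) ^ (k + 1) * X with hu
  have hdvd : (p : (R p)[X]) ^ (k + 2) ∣ u ^ p ^ ν - 1 := by
    obtain ⟨c, hc⟩ := add_natCast_mul_pow_prime_pow (Fact.out : p.Prime) hp 1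
      ((p : (R p)[X]) ^ k * X) ν
    obtain ⟨j, rfl⟩ : ∃ j, ν = j + 1 := ⟨ν - 1, by omega⟩
    rw [hu, pow_succ' _ k, mul_assoc, hc]
    simp only [one_pow]
    exact ⟨(p : (R p)[X]) ^ j * X * (1 + (p : (R p)[X]) * c), by ring⟩
  obtain ⟨F, hF⟩ := exists_muJetRing_point (n := k + 1) (ν := ν) u
    (J := Ideal.span {(p : (R p)[X])}) (Ideal.mem_span_singleton_self _) (by
      intro i hi
      rw [Ideal.mem_span_singleton]
      simpa using dvd_iterate_tDelta i 1 ((pow_dvd_pow _ (by omega)).trans hdvd))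
  obtain ⟨g, hg⟩ := iterate_tDelta_one_add (p := p) hp k 0
  set y : truncation p 1 (k + 1) := ⟨MvPolynomial.X (0, k + 1), X_mem_truncation le_rfl⟩
  have hy : F (toMuJetRing _ ν y) = Ideal.Quotient.mk _ (X ^ p ^ (k + 1)) := by
    rw [hF, Ideal.Quotient.eq, Ideal.mem_span_singleton]
    refine ⟨g, ?_⟩
    rw [deltaEval_X, hu]
    simp only [zero_add, pow_zero, one_mul] at hg
    rw [hg]; ring
  obtain ⟨f, hf, hfy⟩ := Algebra.IsIntegral.isIntegral (R := R p) (toMuJetRing (k + 1) ν y)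
  have h0 := congrArg F hfy
  rw [hom_eval₂, map_zero, hy] at h0
  have hcomp : F.comp (algebraMap (R p) (MuJetRing p (k + 1) ν)) = (Ideal.Quotient.mk _).comp C := by
    ext a
    rw [RingHom.comp_apply, algebraMap_muJetRing, hF]
    exact congrArg _ ((deltaEval u).commutes a)
  rw [hcomp, ← hom_eval₂, Ideal.Quotient.eq_zero_iff_mem, Ideal.mem_span_singleton] at h0
  -- The integral equation becomes `f(t^(p^n)) ≡ 0` mod `p`, and this substitution keeps `f` monic.
  have he : f.eval₂ C (X ^ p ^ (k + 1)) = expand (R p) (p ^ (k + 1)) f := by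
    rw [expand_eq_comp_X_pow]; rfl
  rw [he] at h0
  exact not_natCast_dvd_one (natCast_dvd_one_of_dvd_monic
    (hf.expand (Nat.pow_pos (Fact.out : p.Prime).pos)) h0)

/-! ### Torsion and non-flatness -/

/-- Expand `p δ(x^(p^ν) - 1) = (x^p + p x')^(p^ν) - 1 - (x^(p^ν) - 1)^p` and use `x^(p^ν) = 1`: only
the terms containing `x'` survive, all multiples of `p^(ν+1)`. -/
theorem exists_torsion_muJetRing (hp : p ≠ 2) {n : ℕ} (hn : 1 ≤ n) (ν : ℕ) :
    ∃ c : truncation p 1 n, (p : MuJetRing p n ν) ^ (ν + 1) * toMuJetRing n ν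
      ((⟨MvPolynomial.X (0, 1), X_mem_truncation hn⟩ : truncation p 1 n) *
        (((⟨MvPolynomial.X (0, 0), X_mem_truncation n.zero_le⟩ : truncation p 1 n) ^ p) ^
          (p ^ ν - 1) + (p : truncation p 1 n) * c)) = 0 := by
  set x : truncation p 1 n := ⟨MvPolynomial.X (0, 0), X_mem_truncation n.zero_le⟩ with hx
  set x' : truncation p 1 n := ⟨MvPolynomial.X (0, 1), X_mem_truncation hn⟩ with hx'
  obtain ⟨c, hc⟩ := add_natCast_mul_pow_prime_pow (Fact.out : p.Prime) hp (x ^ p) x' ν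
  refine ⟨c, ?_⟩
  have h0 := toMuJetRing_iterate_delta (p := p) ν n.zero_le
  have h1 := toMuJetRing_iterate_delta (p := p) ν hn
  set d : truncation p 1 n := ⟨delta^[1] (ofPoly (muEquation p ν 0)), iterate_delta_mem _ hn⟩
    with hd
  have e0 : (⟨delta^[0] (ofPoly (muEquation p ν 0)), iterate_delta_mem _ n.zero_le⟩ :
      truncation p 1 n) = x ^ p ^ ν - 1 := Subtype.ext (ofPoly_muEquation ν 0)
  have e1 : (p : truncation p 1 n) * d = (x ^ p + p * x') ^ p ^ ν - 1 - (x ^ p ^ ν - 1) ^ p := by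
    refine Subtype.ext ((natCast_mul_delta _).trans ?_)
    rw [ofPoly_muEquation]
    simp [polyFrob, hx, hx']
  rw [e0, map_sub, map_pow, map_one, sub_eq_zero] at h0
  have h2 := congrArg (toMuJetRing n ν) e1
  rw [hc] at h2
  simp only [map_mul, map_sub, map_add, map_pow, map_one, h1, h0, map_natCast] at h2 ⊢
  rw [← pow_mul, mul_comm p, pow_mul, h0, one_pow, sub_self,
    zero_pow (Fact.out : p.Prime).ne_zero] at h2
  linear_combination -h2

/-- The element is `p^2 t s`. It and its first `δ` are still divisible by `p`. The second `δ` may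
lose the last `p`, but by then `t` has become `t^(p^2)`, a factor that further `δ`'s preserve; hence
the second generator and the absence of a bound on `i`. -/
theorem iterate_tDelta_one_add_pow_mem (hp : p ≠ 2) {ν : ℕ} (hν : 1 ≤ ν) (i : ℕ) :
    tDelta^[i] ((1 + (p : (R p)[X]) * X) ^ p ^ ν - 1) ∈
      Ideal.span {(p : (R p)[X]), X ^ p ^ 2} := by
  have hpJ : (p : (R p)[X]) ∈ Ideal.span {(p : (R p)[X]), X ^ p ^ 2} := Ideal.subset_span (by simp)
  have hXJ : (X ^ p ^ 2 : (R p)[X]) ∈ Ideal.span {(p : (R p)[X]), X ^ p ^ 2} :=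
    Ideal.subset_span (by simp)
  obtain ⟨s, hs⟩ : ∃ s, (1 + (p : (R p)[X]) * X) ^ p ^ ν - 1 =
      X ^ 1 * ((p : (R p)[X]) ^ (1 + 1) * s) := by
    obtain ⟨c, hc⟩ := add_natCast_mul_pow_prime_pow (Fact.out : p.Prime) hp 1 (X : (R p)[X]) ν
    obtain ⟨j, rfl⟩ : ∃ j, ν = j + 1 := ⟨ν - 1, by omega⟩
    refine ⟨p ^ j * (1 + p * c), ?_⟩
    rw [hc]
    simp only [one_pow]
    ring
  obtain ⟨s₁, hs₁⟩ := tDelta_natCast_pow_mul 1 s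
  have h1 : tDelta (X ^ 1 * ((p : (R p)[X]) ^ (1 + 1) * s)) =
      X ^ p * ((p : (R p)[X]) ^ 1 * (tFrob p s + (p : (R p)[X]) * s₁)) := by
    rw [tDelta_X_pow_mul, hs₁, one_mul]
  rw [hs]
  match i with
  | 0 => exact Ideal.mem_of_dvd _ ⟨X * ((p : (R p)[X]) * s), by simp; ring⟩ hpJ
  | 1 => exact Ideal.mem_of_dvd _ ⟨X ^ p * (tFrob p s + (p : (R p)[X]) * s₁), by
      rw [Function.iterate_one, h1]; ring⟩ hpJ
  | i + 2 =>
    refine Ideal.mem_of_dvd _ ?_ hXJ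
    rw [Function.iterate_add_apply]
    refine X_pow_dvd_iterate_tDelta i _ ?_
    rw [Function.iterate_succ_apply, Function.iterate_one, h1, tDelta_X_pow_mul, ← sq]
    exact dvd_mul_right _ _

theorem X_pow_notMem_span :
    (X ^ p : (R p)[X]) ∉ Ideal.span {(p : (R p)[X]), X ^ p ^ 2} := by
  intro h
  obtain ⟨a, b, hab⟩ := Ideal.mem_span_pair.1 h
  have hlt : p < p ^ 2 := by nlinarith [(Fact.out : p.Prime).two_le]
  have := congrArg (coeff · p) hab
  simp only [coeff_add, coeff_mul_natCast, coeff_mul_X_pow', coeff_X_pow, if_neg hlt.not_ge,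
    if_true, add_zero] at this
  exact not_natCast_dvd_one ⟨a.coeff p, by rw [← this, mul_comm]⟩

theorem not_flat_muJetRing (hp : p ≠ 2) {n ν : ℕ} (hn : 1 ≤ n) (hν : 1 ≤ ν) :
    ¬ Module.Flat (R p) (MuJetRing p n ν) := by
  intro hflat
  have hreg : ∀ (m : ℕ) (y : MuJetRing p n ν), (p : MuJetRing p n ν) ^ m * y = 0 → y = 0 := by
    intro m
    have hp1 : IsSMulRegular (R p) (p : R p) := fun a b h =>
      sub_eq_zero.1 (eq_zero_of_natCast_mul (by rw [mul_sub]; exact sub_eq_zero.2 h))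
    have hp2 := (IsSMulRegular.of_flat (S := MuJetRing p n ν) hp1).pow m
    intro y hy
    refine hp2 ?_
    simpa [map_natCast] using hy
  obtain ⟨c, hc⟩ := exists_torsion_muJetRing (p := p) hp hn ν
  obtain ⟨F, hF⟩ := exists_muJetRing_point (n := n) (ν := ν) (1 + (p : (R p)[X]) * X)
    (J := Ideal.span {(p : (R p)[X]), X ^ p ^ 2}) (Ideal.subset_span (by simp))
    fun i _ => iterate_tDelta_one_add_pow_mem hp hν i
  obtain ⟨g, hg⟩ := tDelta_one_add hp 0 (X : (R p)[X])
  -- After cancelling `p^(ν+1)`, apply `F`: modulo `p`, `x` goes to `1` and `x'` to `t^p`.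
  have h0 := congrArg F (hreg _ _ hc)
  have hpz : Ideal.Quotient.mk (Ideal.span {(p : (R p)[X]), X ^ p ^ 2}) (p : (R p)[X]) = 0 :=
    Ideal.Quotient.eq_zero_iff_mem.2 (Ideal.subset_span (by simp))
  rw [hF] at h0
  simp only [zero_add, pow_one, pow_zero, one_mul, tFrob_X] at hg
  simp only [MulMemClass.coe_mul, AddMemClass.coe_add, SubmonoidClass.coe_pow, map_mul, map_add,
    map_pow, deltaEval_X, Function.iterate_zero, Function.iterate_one, id_eq, hg,
    map_one, hpz, SubringClass.coe_natCast, map_natCast, zero_mul, add_zero, one_pow, mul_one,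
    map_zero] at h0
  rw [← map_pow] at h0
  exact X_pow_notMem_span (Ideal.Quotient.eq_zero_iff_mem.1 h0)

end PJet

end

theorem proposition5p8 (p : ℕ) [Fact p.Prime] (hp : p ≠ 2) (n ν : ℕ) (hn : 1 ≤ n) (hν : 1 ≤ ν) :
    (¬ Module.Finite (PJet.R p) (PJet.MuJetRing p n ν)) ∧
      (¬ Module.Flat (PJet.R p) (PJet.MuJetRing p n ν)) :=
  ⟨PJet.not_finite_muJetRing hp hn hν, PJet.not_flat_muJetRing hp hn hν⟩
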